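/- Let $(a_n)_{n\in\mathbb{Z}}$ be independent, identically distributed real random variables on a probability space $(\Omega,\mathcal{F},\mathbb{P})$, and suppose there are constants $0<a_-\le a_+<\infty$ such that, almost surely, $a_-\le a_n\le a_+$ for all $n\in\mathbb{Z}$. Let $H_\omega$ be the random Jacobi operator (the div-grad model) \[ (H_\omega\phi)_n=-a_{n+1}\phi_{n+1}+(a_{n+1}+a_n)\phi_n-a_n\phi_{n-1},\qquad n\in\mathbb{Z}. \] For $N\ge 1$ let $H_{N,\omega}$ be the restriction of $H_\omega$ to $\{0,\dots,N-1\}$ with Dirichlet boundary conditions $\psi_{-1}=\psi_N=0$, and let $E_1^N(\omega)\le\dots\le E_N^N(\omega)$ be its eigenvalues, counted with multiplicity. Then for every $E\in\mathbb{R}$ the limit \[ \mathcal{N}(E)=\lim_{N\to\infty}\frac1N\,\#\{\,j: E_j^N(\omega)\le E\,\} \] exists almost surely and is non-random, and the function $\mathcal{N}$ so defined (the integrated density of states of $H_\omega$) satisfies \[ \mathcal{N}(E)=\frac{1}{\pi\sqrt{\kappa}}\sqrt{E}+O(E)\qquad\text{as }E\to0^+,\qquad \kappa=\big[\mathbb{E}(a_0^{-1})\big]^{-1}.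 \] -/

import Mathlib

open MeasureTheory ProbabilityTheory Filter Topology Asymptotics

namespace DivGrad

/-- The div-grad (divergence-gradient) Jacobi operator with coefficients `a`, acting on sequences
indexed by `ℤ`. -/
def op (a : ℤ → ℝ) (φ : ℤ → ℝ) : ℤ → ℝ := fun n =>
  -(a (n + 1) * φ (n + 1)) + (a (n + 1) + a n) * φ n - a n * φ (n - 1)

/-- The restriction of the div-grad operator to the interval `[0, N - 1]` with Dirichlet boundary
conditions `ψ (-1) = ψ N = 0`, as a matrix: the `(i, j)` entry is `(op a δ_j) i`. -/
def boxMatrix (a : ℤ → ℝ) (N : ℕ) : Matrix (Fin N) (Fin N) ℝ :=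
  Matrix.of fun i j => op a (Pi.single (j : ℤ) 1) (i : ℤ)

theorem boxMatrix_isHermitian (a : ℤ → ℝ) (N : ℕ) : (boxMatrix a N).IsHermitian := by
  ext i j
  simp only [boxMatrix, op, Matrix.conjTranspose_apply, Matrix.of_apply, star_trivial,
    Pi.single_apply]
  rcases lt_trichotomy (i : ℤ) (j : ℤ) with h | h | h
  · by_cases h1 : (j : ℤ) = i + 1
    · simp [h1, show ¬ ((i : ℤ) + 1 + 1 = i) by omega, show ¬ ((i : ℤ) - 1 = i + 1) by omega]
    · simp [show ¬ ((j : ℤ) + 1 = i) by omega, show ¬ ((j : ℤ) = i) by omega,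
        show ¬ ((j : ℤ) - 1 = i) by omega, show ¬ ((i : ℤ) + 1 = j) by omega,
        show ¬ ((i : ℤ) = j) by omega, show ¬ ((i : ℤ) - 1 = j) by omega]
  · simp [h]
  · by_cases h1 : (i : ℤ) = j + 1
    · simp [h1, show ¬ ((j : ℤ) + 1 + 1 = j) by omega, show ¬ ((j : ℤ) - 1 = j + 1) by omega]
    · simp [show ¬ ((j : ℤ) + 1 = i) by omega, show ¬ ((j : ℤ) = i) by omega,
        show ¬ ((j : ℤ) - 1 = i) by omega, show ¬ ((i : ℤ) + 1 = j) by omega,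
        show ¬ ((i : ℤ) = j) by omega, show ¬ ((i : ℤ) - 1 = j) by omega]

/-- The number of eigenvalues, counted with multiplicity, of the restriction to `[0, N - 1]` that
are at most `E`. -/
noncomputable def eigCount (a : ℤ → ℝ) (N : ℕ) (E : ℝ) : ℕ :=
  Nat.card {j : Fin N // (boxMatrix_isHermitian a N).eigenvalues j ≤ E}

/-- `𝒩` is the integrated density of states of the random div-grad operator with coefficients
`a n ω`: for every energy `E`, the number `𝒩 E` is the almost sure limit of the normalized
eigenvalue counts of the restrictions to `[0, N - 1]`. -/
def IsIDS {Ω : Type*} [MeasurableSpace Ω] (μ : Measure Ω) (a : ℤ → Ω → ℝ) (𝒩 : ℝ → ℝ) : Prop :=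
  ∀ E : ℝ, ∀ᵐ ω ∂μ,
    Tendsto (fun N : ℕ => (eigCount (fun n => a n ω) N E : ℝ) / (N : ℝ)) atTop (𝓝 (𝒩 E))

/-- The harmonic mean `κ = (𝔼[a₀⁻¹])⁻¹`. -/
noncomputable def kappa {Ω : Type*} [MeasurableSpace Ω] (μ : Measure Ω) (a : ℤ → Ω → ℝ) : ℝ :=
  (∫ ω, (a 0 ω)⁻¹ ∂μ)⁻¹

end DivGrad

/-!
By a discrete Picone identity, the sign changes on `[0, N]` of any solution of `H u = E u` count the
eigenvalues at most `E` up to an error of one. Hence sign changes are almost additive under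
concatenation of boxes, and the strong law of large numbers on blocks gives a nonrandom density,
which is also the limit of the means.

Write the equation as a first-order system for `u` and its flux `v`, and put `(v / s, u)` in the
plane. A step of the recursion is a product of two shears, and each half turn is one sign change.
To first order the shears rotate at the rates `E / s` and `s / a (n + 1)`, weighted by
complementary factors that depend on the angle alone. At the scale `s = √(E κ)` the two rates have
the same mean `√E / √κ`, and the angle is independent of `a (n + 1)`, so the mean rotation per step
is `√E / √κ` up to second-order terms, which are of order `E`.
-/

namespace DivGrad

section MinMax

open Matrix

variable {n : Type*} [Fintype n] [DecidableEq n] {A : Matrix n n ℝ} (hA : A.IsHermitian)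

theorem eigenvectorBasis_dotProduct_mulVec (j : n) (φ : n → ℝ) :
    (hA.eigenvectorBasis j).ofLp ⬝ᵥ (A *ᵥ φ) =
      hA.eigenvalues j * ((hA.eigenvectorBasis j).ofLp ⬝ᵥ φ) := by
  have hsymm : Aᵀ = A := by rw [← conjTranspose_eq_transpose_of_trivial, hA.eq]
  rw [dotProduct_mulVec, ← mulVec_transpose, hsymm, hA.mulVec_eigenvectorBasis, smul_dotProduct,
    smul_eq_mul]

theorem sum_eigenvectorBasis_dotProduct_mul (φ χ : n → ℝ) :
    ∑ j, ((hA.eigenvectorBasis j).ofLp ⬝ᵥ φ) * ((hA.eigenvectorBasis j).ofLp ⬝ᵥ χ) = φ ⬝ᵥ χ := by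
  have h := hA.eigenvectorBasis.sum_inner_mul_inner (WithLp.toLp 2 φ) (WithLp.toLp 2 χ)
  simpa only [EuclideanSpace.inner_eq_star_dotProduct, star_trivial, dotProduct_comm χ φ,
    dotProduct_comm χ, dotProduct_comm _ φ] using h

theorem form_sub_eq_sum_eigenvalues (E : ℝ) (φ : n → ℝ) :
    φ ⬝ᵥ (A *ᵥ φ) - E * (φ ⬝ᵥ φ) =
      ∑ j, (hA.eigenvalues j - E) * ((hA.eigenvectorBasis j).ofLp ⬝ᵥ φ) ^ 2 := by
  rw [← sum_eigenvectorBasis_dotProduct_mul hA φ (A *ᵥ φ),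
    ← sum_eigenvectorBasis_dotProduct_mul hA φ φ, Finset.mul_sum, ← Finset.sum_sub_distrib]
  refine Finset.sum_congr rfl fun j _ => ?_
  rw [eigenvectorBasis_dotProduct_mulVec]
  ring

theorem mulVec_eq_smul_of_dotProduct_eigenvectorBasis {E : ℝ} {φ : n → ℝ}
    (h : ∀ j, (hA.eigenvalues j - E) * ((hA.eigenvectorBasis j).ofLp ⬝ᵥ φ) = 0) :
    A *ᵥ φ = E • φ := by
  have hcoord : ∀ j, (hA.eigenvectorBasis j).ofLp ⬝ᵥ (A *ᵥ φ - E • φ) = 0 := fun j => by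
    rw [dotProduct_sub, eigenvectorBasis_dotProduct_mulVec, dotProduct_smul, smul_eq_mul, ← sub_mul,
      h j]
  rw [← sub_eq_zero, ← dotProduct_self_eq_zero, ← sum_eigenvectorBasis_dotProduct_mul hA]
  simp only [hcoord, mul_zero, Finset.sum_const_zero]

variable {W : Type*} [AddCommGroup W] [Module ℝ W] [FiniteDimensional ℝ W]

theorem exists_ne_zero_mem_ker_of_finrank_lt (p : n → Prop) (L : (n → ℝ) →ₗ[ℝ] W)
    (h : Module.finrank ℝ W < Nat.card {j // p j}) :
    ∃ φ, φ ≠ 0 ∧ L φ = 0 ∧ ∀ j, ¬ p j → (hA.eigenvectorBasis j).ofLp ⬝ᵥ φ = 0 := by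
  classical
  let coords : (n → ℝ) →ₗ[ℝ] ({j // ¬ p j} → ℝ) :=
    LinearMap.pi fun j => dotProductBilin ℝ ℝ (hA.eigenvectorBasis j).ofLp
  have hcard := Fintype.card_subtype_compl p
  have hle := Fintype.card_subtype_le p
  have hlt : Module.finrank ℝ (W × ({j // ¬ p j} → ℝ)) < Module.finrank ℝ (n → ℝ) := by
    rw [Nat.card_eq_fintype_card] at h
    rw [Module.finrank_prod, Module.finrank_pi, Module.finrank_pi]
    omega
  obtain ⟨φ, hφ, hφ0⟩ := Submodule.exists_mem_ne_zero_of_ne_bot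
    (LinearMap.ker_ne_bot_of_finrank_lt (f := L.prod coords) hlt)
  obtain ⟨hL, hcoords⟩ := Prod.mk_eq_zero.1 (LinearMap.mem_ker.1 hφ)
  exact ⟨φ, hφ0, hL, fun j hj => congrFun hcoords ⟨j, hj⟩⟩

theorem card_eigenvalues_le_of_nonneg_on_ker (L : (n → ℝ) →ₗ[ℝ] W) {E : ℝ}
    (hform : ∀ φ, L φ = 0 → 0 ≤ φ ⬝ᵥ (A *ᵥ φ) - E * (φ ⬝ᵥ φ))
    (heigen : ∀ φ, L φ = 0 → A *ᵥ φ = E • φ → φ = 0) :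
    Nat.card {j // hA.eigenvalues j ≤ E} ≤ Module.finrank ℝ W := by
  by_contra! h
  obtain ⟨φ, hφ0, hL, hφ⟩ :=
    exists_ne_zero_mem_ker_of_finrank_lt hA (fun j => hA.eigenvalues j ≤ E) L h
  have hterm : ∀ j ∈ Finset.univ,
      (hA.eigenvalues j - E) * ((hA.eigenvectorBasis j).ofLp ⬝ᵥ φ) ^ 2 ≤ 0 := fun j _ => by
    by_cases hj : hA.eigenvalues j ≤ E
    · exact mul_nonpos_of_nonpos_of_nonneg (sub_nonpos.2 hj) (sq_nonneg _)
    · simp [hφ j hj]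
  have hsum := le_antisymm (Finset.sum_nonpos hterm)
    (form_sub_eq_sum_eigenvalues hA E φ ▸ hform φ hL)
  refine hφ0 (heigen φ hL (mulVec_eq_smul_of_dotProduct_eigenvectorBasis hA fun j => ?_))
  simpa using (Finset.sum_eq_zero_iff_of_nonpos hterm).1 hsum j (Finset.mem_univ j)

theorem card_le_card_eigenvalues_add_of_nonpos_on_ker (L : (n → ℝ) →ₗ[ℝ] W) {E : ℝ}
    (hform : ∀ φ, L φ = 0 → φ ⬝ᵥ (A *ᵥ φ) - E * (φ ⬝ᵥ φ) ≤ 0) :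
    Fintype.card n ≤ Nat.card {j // hA.eigenvalues j ≤ E} + Module.finrank ℝ W := by
  classical
  by_contra! h
  have hcard := Fintype.card_subtype_compl fun j => hA.eigenvalues j ≤ E
  obtain ⟨φ, hφ0, hL, hφ⟩ :=
    exists_ne_zero_mem_ker_of_finrank_lt hA (fun j => ¬ hA.eigenvalues j ≤ E) L (by
      rw [Nat.card_eq_fintype_card] at h ⊢
      omega)
  have hterm : ∀ j ∈ Finset.univ,
      0 ≤ (hA.eigenvalues j - E) * ((hA.eigenvectorBasis j).ofLp ⬝ᵥ φ) ^ 2 := fun j _ => by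
    by_cases hj : hA.eigenvalues j ≤ E
    · simp [hφ j (not_not.2 hj)]
    · exact mul_nonneg (sub_nonneg.2 (not_le.1 hj).le) (sq_nonneg _)
  have hsum := le_antisymm (form_sub_eq_sum_eigenvalues hA E φ ▸ hform φ hL)
    (Finset.sum_nonneg hterm)
  refine hφ0 (dotProduct_self_eq_zero.1 ?_)
  rw [← sum_eigenvectorBasis_dotProduct_mul hA]
  refine Finset.sum_eq_zero fun j _ => mul_self_eq_zero.2 ?_
  by_cases hj : hA.eigenvalues j ≤ E
  · exact hφ j (not_not.2 hj)
  · simpa [sub_ne_zero.2 (not_le.1 hj).ne'] using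
      (Finset.sum_eq_zero_iff_of_nonneg hterm).1 hsum j (Finset.mem_univ j)

end MinMax

/-- Extension by zero of a vector on the box `[0, N - 1]` to a sequence on `ℤ`. -/
noncomputable def zeroExtend (N : ℕ) : (Fin N → ℝ) →ₗ[ℝ] (ℤ → ℝ) :=
  Fintype.linearCombination ℝ fun j : Fin N => Pi.single (j : ℤ) 1

theorem zeroExtend_apply {N : ℕ} (φ : Fin N → ℝ) (k : ℤ) :
    zeroExtend N φ k = ∑ j : Fin N, φ j * (Pi.single (j : ℤ) 1 : ℤ → ℝ) k := by
  simp only [zeroExtend, Fintype.linearCombination_apply, Finset.sum_apply, Pi.smul_apply,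
    smul_eq_mul]

theorem zeroExtend_coe {N : ℕ} (φ : Fin N → ℝ) (i : Fin N) : zeroExtend N φ i = φ i := by
  simp [zeroExtend_apply, Pi.single_apply, Fin.val_inj]

theorem zeroExtend_eq_zero {N : ℕ} (φ : Fin N → ℝ) {k : ℤ} (hk : k < 0 ∨ N ≤ k) :
    zeroExtend N φ k = 0 := by
  rw [zeroExtend_apply]
  refine Finset.sum_eq_zero fun j _ => ?_
  rw [Pi.single_eq_of_ne (by omega), mul_zero]

theorem boxMatrix_mulVec (a : ℤ → ℝ) {N : ℕ} (φ : Fin N → ℝ) (i : Fin N) :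
    (boxMatrix a N).mulVec φ i = op a (zeroExtend N φ) i := by
  simp only [Matrix.mulVec, dotProduct, boxMatrix, Matrix.of_apply, op, zeroExtend_apply,
    Finset.mul_sum, ← Finset.sum_neg_distrib, ← Finset.sum_add_distrib, ← Finset.sum_sub_distrib]
  exact Finset.sum_congr rfl fun j _ => by ring

theorem sum_range_mul_op (a ψ : ℤ → ℝ) (N : ℕ) :
    ∑ n ∈ Finset.range N, ψ n * op a ψ n =
      ∑ n ∈ Finset.range N, a (n + 1) * (ψ (n + 1) - ψ n) ^ 2 +
        ψ 0 * (a 0 * (ψ 0 - ψ (-1))) - ψ N * (a N * (ψ N - ψ (N - 1))) := by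
  induction N with
  | zero => simp
  | succ N ih =>
    rw [Finset.sum_range_succ, Finset.sum_range_succ, ih]
    push_cast
    rw [add_sub_cancel_right, op]
    ring

theorem form_boxMatrix (a : ℤ → ℝ) (E : ℝ) {N : ℕ} {φ : Fin N → ℝ} (h0 : zeroExtend N φ 0 = 0) :
    φ ⬝ᵥ ((boxMatrix a N).mulVec φ) - E * (φ ⬝ᵥ φ) =
      ∑ n ∈ Finset.range N, (a (n + 1) * (zeroExtend N φ (n + 1) - zeroExtend N φ n) ^ 2 -
        E * zeroExtend N φ n ^ 2) := by
  have hsum := sum_range_mul_op a (zeroExtend N φ) N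
  rw [h0, zeroExtend_eq_zero φ (Or.inr le_rfl), zero_mul, zero_mul, add_zero, sub_zero] at hsum
  rw [Finset.sum_sub_distrib, ← hsum, ← Finset.mul_sum,
    ← Fin.sum_univ_eq_sum_range (fun n => zeroExtend N φ n * op a (zeroExtend N φ) n),
    ← Fin.sum_univ_eq_sum_range (fun n => zeroExtend N φ n ^ 2)]
  simp only [dotProduct, boxMatrix_mulVec, zeroExtend_coe, sq]

theorem eq_zero_of_boxMatrix_mulVec_eq_smul {a : ℤ → ℝ} (ha : ∀ n, a n ≠ 0) {E : ℝ} {N : ℕ}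
    {φ : Fin N → ℝ} (h0 : zeroExtend N φ 0 = 0) (hφ : (boxMatrix a N).mulVec φ = E • φ) :
    φ = 0 := by
  have hprop : ∀ n : ℕ, n ≤ N → zeroExtend N φ n = 0 ∧ zeroExtend N φ ((n : ℤ) - 1) = 0 := by
    intro n
    induction n with
    | zero => exact fun _ => ⟨h0, zeroExtend_eq_zero φ (by simp)⟩
    | succ n ih =>
      intro hn
      obtain ⟨hcurr, hprev⟩ := ih (by omega)
      have hrow := congrFun hφ ⟨n, by omega⟩
      rw [boxMatrix_mulVec, Pi.smul_apply, ← zeroExtend_coe φ] at hrow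
      simp only [op, hcurr, hprev, smul_eq_mul, mul_zero, add_zero, sub_zero, neg_eq_zero,
        mul_eq_zero, ha, false_or] at hrow
      push_cast
      exact ⟨hrow, by rwa [add_sub_cancel_right]⟩
  ext i
  rw [← zeroExtend_coe φ]
  exact (hprop i i.2.le).1

/-- A nontrivial solution of the eigenvalue equation at energy `E` on the half line, as the pair
of the solution `u` and its flux `v n = a n * (u n - u (n - 1))`. -/
structure IsSolution (a : ℤ → ℝ) (E : ℝ) (u v : ℕ → ℝ) : Prop where
  flux : ∀ n, v (n + 1) = v n - E * u n
  grad : ∀ n : ℕ, a (n + 1) * (u (n + 1) - u n) = v (n + 1)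
  nontrivial : ∀ n, u n ≠ 0 ∨ v n ≠ 0

/-- `u` changes sign along the edge from `n` to `n + 1`; a zero of `u` counts for the edge that
leads to it. -/
def IsCrossing (u : ℕ → ℝ) (n : ℕ) : Prop := u n ≠ 0 ∧ u n * u (n + 1) ≤ 0

noncomputable instance (u : ℕ → ℝ) : DecidablePred (IsCrossing u) := fun n =>
  inferInstanceAs (Decidable (u n ≠ 0 ∧ u n * u (n + 1) ≤ 0))

/-- The number of sign changes of `u` on `[0, N]`. -/
noncomputable def crossings (u : ℕ → ℝ) (N : ℕ) : ℕ := Nat.count (IsCrossing u) N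

/-- The constraints `ψ 0 = 0` and `u n * ψ (n + 1) = u (n + 1) * ψ n` for `n ∈ s` on the zero
extension `ψ` of a vector; the latter forbid `ψ / u` to jump along the edges in `s`. -/
noncomputable def constraints (u : ℕ → ℝ) (N : ℕ) (s : Finset ℕ) :
    (Fin N → ℝ) →ₗ[ℝ] ℝ × (s → ℝ) :=
  (LinearMap.prod (LinearMap.proj 0) (LinearMap.pi fun n : s =>
    u n • LinearMap.proj ((n : ℤ) + 1) - u (n + 1) • LinearMap.proj (n : ℤ))) ∘ₗ zeroExtend N

theorem constraints_eq_zero_iff {u : ℕ → ℝ} {N : ℕ} {s : Finset ℕ} {φ : Fin N → ℝ} :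
    constraints u N s φ = 0 ↔ zeroExtend N φ 0 = 0 ∧
      ∀ n ∈ s, u n * zeroExtend N φ (n + 1) = u (n + 1) * zeroExtend N φ n := by
  simp [constraints, Prod.ext_iff, funext_iff, sub_eq_zero]

theorem finrank_codomain_constraints (s : Finset ℕ) :
    Module.finrank ℝ (ℝ × (s → ℝ)) = s.card + 1 := by
  rw [Module.finrank_prod, Module.finrank_self, Module.finrank_fintype_fun_eq_card,
    Fintype.card_coe, add_comm]

theorem crossings_add (u : ℕ → ℝ) (m n : ℕ) :
    crossings u (m + n) = crossings u m + crossings (fun k => u (m + k)) n :=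
  Nat.count_add _ _ _

namespace IsSolution

variable {a : ℤ → ℝ} {E : ℝ} {u v : ℕ → ℝ}

theorem shift (h : IsSolution a E u v) (m : ℕ) :
    IsSolution (fun k => a (m + k)) E (fun k => u (m + k)) (fun k => v (m + k)) where
  flux n := h.flux (m + n)
  grad n := by simpa only [Nat.cast_add, add_assoc] using h.grad (m + n)
  nontrivial n := h.nontrivial (m + n)

theorem succ_ne_zero (h : IsSolution a E u v) {n : ℕ} (hn : u n = 0) : u (n + 1) ≠ 0 := by
  intro hn'
  have hv := h.grad n
  rw [hn, hn', sub_zero, mul_zero] at hv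
  exact (h.nontrivial (n + 1)).elim (· hn') (· hv.symm)

theorem nontrivial_flux_succ (h : IsSolution a E u v) (n : ℕ) : u n ≠ 0 ∨ v (n + 1) ≠ 0 := by
  have hn := h.nontrivial n
  contrapose! hn
  have hflux := h.flux n
  rw [hn.1, hn.2, mul_zero, sub_zero] at hflux
  exact ⟨hn.1, hflux.symm⟩

theorem flux_eq (h : IsSolution a E u v) (n : ℕ) :
    v n = a (n + 1) * (u (n + 1) - u n) + E * u n := by
  rw [h.grad, h.flux, sub_add_cancel]

-- By the convention `x / 0 = 0` the identity also holds at the zeros of `u`.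
theorem picone_identity (h : IsSolution a E u v) (ψ : ℕ → ℝ) {n : ℕ}
    (hn : u n = 0 → ψ n = 0) (hn' : u (n + 1) = 0 → ψ (n + 1) = 0) :
    a (n + 1) * (ψ (n + 1) - ψ n) ^ 2 - E * ψ n ^ 2 =
      a (n + 1) * (u n * u (n + 1)) * (ψ (n + 1) / u (n + 1) - ψ n / u n) ^ 2 +
        (ψ (n + 1) ^ 2 * v (n + 1) / u (n + 1) - ψ n ^ 2 * v n / u n) := by
  rw [h.flux_eq n, ← h.grad n]
  by_cases hu : u n = 0
  · have hu' := h.succ_ne_zero hu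
    rw [hu, hn hu]
    field_simp
    ring
  by_cases hu' : u (n + 1) = 0
  · rw [hu', hn' hu']
    field_simp
    ring
  field_simp
  ring

theorem form_boxMatrix_eq (h : IsSolution a E u v) {N : ℕ} {φ : Fin N → ℝ}
    (h0 : zeroExtend N φ 0 = 0) (hz : ∀ n : ℕ, n ≤ N → u n = 0 → zeroExtend N φ n = 0) :
    φ ⬝ᵥ ((boxMatrix a N).mulVec φ) - E * (φ ⬝ᵥ φ) =
      ∑ n ∈ Finset.range N, a (n + 1) * (u n * u (n + 1)) *
        (zeroExtend N φ (n + 1) / u (n + 1) - zeroExtend N φ n / u n) ^ 2 := by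
  set ψ := zeroExtend N φ
  have htelescope := Finset.sum_range_sub (fun n : ℕ => ψ n ^ 2 * v n / u n) N
  have hN : ψ N = 0 := zeroExtend_eq_zero φ (Or.inr le_rfl)
  simp only [hN, Nat.cast_zero, h0, ne_eq, OfNat.ofNat_ne_zero, not_false_eq_true, zero_pow,
    zero_mul, zero_div, sub_zero] at htelescope
  rw [form_boxMatrix a E h0, ← sub_eq_zero, ← Finset.sum_sub_distrib]
  refine (Finset.sum_congr rfl fun n hn => sub_eq_iff_eq_add'.2 ?_).trans htelescope
  have hn := Finset.mem_range.1 hn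
  simpa only [Nat.cast_add, Nat.cast_one] using
    h.picone_identity (fun n : ℕ => ψ n) (hz n hn.le) (hz (n + 1) hn)

theorem eigCount_le (h : IsSolution a E u v) (ha : ∀ n, 0 < a n) (N : ℕ) :
    eigCount a N E ≤ crossings u N + 1 := by
  rw [crossings, Nat.count_eq_card_filter_range, ← finrank_codomain_constraints]
  refine card_eigenvalues_le_of_nonneg_on_ker _ (constraints u N _) (fun φ hφ => ?_)
    fun φ hφ => eq_zero_of_boxMatrix_mulVec_eq_smul (fun n => (ha n).ne')
      (constraints_eq_zero_iff.1 hφ).1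
  obtain ⟨h0, hmatch⟩ := constraints_eq_zero_iff.1 hφ
  simp only [Finset.mem_filter, Finset.mem_range] at hmatch
  have hz : ∀ n : ℕ, n ≤ N → u n = 0 → zeroExtend N φ n = 0 := by
    rintro (_ | n) hn hu
    · exact h0
    · have hun : u n ≠ 0 := fun hun => h.succ_ne_zero hun hu
      have hedge := hmatch n ⟨hn, hun, by simp [hu]⟩
      rw [hu, zero_mul] at hedge
      exact_mod_cast (mul_eq_zero.1 hedge).resolve_left hun
  rw [h.form_boxMatrix_eq h0 hz]
  refine Finset.sum_nonneg fun n hn => ?_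
  by_cases hpos : 0 ≤ u n * u (n + 1)
  · exact mul_nonneg (mul_nonneg (ha _).le hpos) (sq_nonneg _)
  · have hun : u n ≠ 0 := fun hun => hpos (by simp [hun])
    have hun' : u (n + 1) ≠ 0 := fun hun' => hpos (by simp [hun'])
    have hedge := hmatch n ⟨Finset.mem_range.1 hn, hun, (not_le.1 hpos).le⟩
    rw [(div_eq_div_iff hun' hun).2 (by linarith), sub_self, sq, mul_zero, mul_zero]

theorem crossings_le_eigCount (h : IsSolution a E u v) (ha : ∀ n, 0 < a n) (N : ℕ) :
    crossings u N ≤ eigCount a N E + 1 := by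
  have hcard := Finset.card_filter_add_card_filter_not (s := Finset.range N) (IsCrossing u)
  rw [← Nat.count_eq_card_filter_range, Finset.card_range] at hcard
  have hmain := card_le_card_eigenvalues_add_of_nonpos_on_ker (boxMatrix_isHermitian a N)
    (E := E) (constraints u N {n ∈ Finset.range N | ¬ IsCrossing u n}) fun φ hφ => ?_
  · rw [finrank_codomain_constraints, Fintype.card_fin] at hmain
    rw [eigCount, crossings]
    omega
  obtain ⟨h0, hmatch⟩ := constraints_eq_zero_iff.1 hφ
  simp only [Finset.mem_filter, Finset.mem_range] at hmatch
  have hz : ∀ n : ℕ, n ≤ N → u n = 0 → zeroExtend N φ n = 0 := by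
    intro n hn hu
    rcases hn.lt_or_eq with hlt | rfl
    · have hedge := hmatch n ⟨hlt, fun hc => hc.1 hu⟩
      rw [hu, zero_mul] at hedge
      exact (mul_eq_zero.1 hedge.symm).resolve_left (h.succ_ne_zero hu)
    · exact zeroExtend_eq_zero φ (Or.inr le_rfl)
  rw [h.form_boxMatrix_eq h0 hz]
  refine Finset.sum_nonpos fun n hn => ?_
  by_cases hneg : u n * u (n + 1) ≤ 0
  · exact mul_nonpos_of_nonpos_of_nonneg
      (mul_nonpos_of_nonneg_of_nonpos (ha _).le hneg) (sq_nonneg _)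
  · have hun : u n ≠ 0 := fun hun => hneg (by simp [hun])
    have hun' : u (n + 1) ≠ 0 := fun hun' => hneg (by simp [hun'])
    have hedge := hmatch n ⟨Finset.mem_range.1 hn, fun hc => hneg hc.2⟩
    rw [(div_eq_div_iff hun' hun).2 (by linarith), sub_self, sq, mul_zero, mul_zero]

theorem abs_eigCount_sub_crossings_le (h : IsSolution a E u v) (ha : ∀ n, 0 < a n) (N : ℕ) :
    |(eigCount a N E : ℝ) - crossings u N| ≤ 1 := by
  have hle : (eigCount a N E : ℝ) ≤ crossings u N + 1 := mod_cast h.eigCount_le ha N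
  have hge : (crossings u N : ℝ) ≤ eigCount a N E + 1 := mod_cast h.crossings_le_eigCount ha N
  exact abs_sub_le_iff.2 ⟨by linarith, by linarith⟩

end IsSolution

/-- The solution with `u 0 = 1` and zero flux at the left end, together with its flux. -/
noncomputable def freeSol (a : ℤ → ℝ) (E : ℝ) : ℕ → ℝ × ℝ
  | 0 => (1, 0)
  | n + 1 => ((freeSol a E n).1 + ((freeSol a E n).2 - E * (freeSol a E n).1) / a (n + 1),
      (freeSol a E n).2 - E * (freeSol a E n).1)

theorem isSolution_freeSol {a : ℤ → ℝ} (ha : ∀ n, 0 < a n) (E : ℝ) :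
    IsSolution a E (fun n => (freeSol a E n).1) (fun n => (freeSol a E n).2) where
  flux n := rfl
  grad n := by
    simp only [freeSol, add_sub_cancel_left]
    rw [mul_div_cancel₀ _ (ha _).ne']
  nontrivial n := by
    induction n with
    | zero => simp [freeSol]
    | succ n ih =>
      by_contra! hcon
      simp only [freeSol] at hcon
      obtain ⟨hu, hv⟩ := hcon
      rw [hv, zero_div, add_zero] at hu
      rw [hu, mul_zero, sub_zero] at hv
      exact ih.elim (· hu) (· hv)

/-- The number of sign changes on `[0, N]` of the solution with zero flux at the left end. -/
noncomputable def freeCrossings (a : ℤ → ℝ) (E : ℝ) (N : ℕ) : ℕ :=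
  crossings (fun n => (freeSol a E n).1) N

theorem freeCrossings_le (a : ℤ → ℝ) (E : ℝ) (N : ℕ) : freeCrossings a E N ≤ N :=
  Nat.count_le _

theorem abs_eigCount_sub_freeCrossings_le {a : ℤ → ℝ} (ha : ∀ n, 0 < a n) (E : ℝ) (N : ℕ) :
    |(eigCount a N E : ℝ) - freeCrossings a E N| ≤ 1 :=
  (isSolution_freeSol ha E).abs_eigCount_sub_crossings_le ha N

theorem abs_freeCrossings_add_sub_le {a : ℤ → ℝ} (ha : ∀ n, 0 < a n) (E : ℝ) (m n : ℕ) :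
    |(freeCrossings a E (m + n) : ℝ) -
      (freeCrossings a E m + freeCrossings (fun k => a (m + k)) E n)| ≤ 2 := by
  have ha' : ∀ k : ℤ, 0 < a (m + k) := fun k => ha _
  have hshifted := ((isSolution_freeSol ha E).shift m).abs_eigCount_sub_crossings_le ha' n
  have hfree := abs_eigCount_sub_freeCrossings_le ha' E n
  rw [abs_le] at hshifted hfree ⊢
  rw [freeCrossings, crossings_add, Nat.cast_add, freeCrossings]
  constructor <;> linarith

section Rotation

open Complex ComplexConjugate

theorem abs_arg_one_add_sub_im_le (w : ℂ) : |arg (1 + w) - w.im| ≤ 16 * ‖w‖ ^ 2 := by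
  rcases le_or_gt ‖w‖ (1 / 2) with hw | hw
  · have hlog : ‖log (1 + w) - w‖ ≤ ‖w‖ ^ 2 := by
      refine (norm_log_one_add_sub_self_le (by linarith)).trans ?_
      have hinv : (1 - ‖w‖)⁻¹ ≤ 2 := inv_le_of_inv_le₀ two_pos (by linarith)
      nlinarith [sq_nonneg ‖w‖]
    have him := abs_im_le_norm (log (1 + w) - w)
    rw [sub_im, log_im] at him
    nlinarith [sq_nonneg ‖w‖]
  · have harg := abs_arg_le_pi (1 + w)
    have him := abs_im_le_norm w
    have hsub := abs_sub (arg (1 + w)) w.im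
    nlinarith [Real.pi_lt_d2]

theorem arg_one_add_of_im_eq {w : ℂ} {t c : ℝ} (ht : 0 ≤ t) (hc : |c| ≤ 1)
    (him : w.im = t * c ^ 2) (hnorm : ‖w‖ = t * |c|) :
    arg (1 + w) ∈ Set.Ico 0 Real.pi ∧ |arg (1 + w) - t * c ^ 2| ≤ 16 * t ^ 2 := by
  refine ⟨⟨arg_nonneg_iff.2 ?_, arg_lt_pi_iff.2 ?_⟩, ?_⟩
  · rw [add_im, one_im, zero_add, him]
    positivity
  · rcases eq_or_ne (t * c) 0 with h | h
    · have hw : w = 0 := by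
        rcases mul_eq_zero.1 h with h | h <;> simp [← norm_eq_zero, hnorm, h]
      simp [hw]
    · right
      rw [add_im, one_im, zero_add, him]
      have := mul_ne_zero_iff.1 h
      exact mul_ne_zero this.1 (pow_ne_zero 2 this.2)
  · rw [← him]
    refine (abs_arg_one_add_sub_im_le w).trans ?_
    gcongr
    rw [hnorm]
    exact mul_le_of_le_one_right ht hc

theorem arg_div_vertical_shear {z z' : ℂ} {t : ℝ} (ht : 0 ≤ t) (hz : z ≠ 0)
    (hre : z'.re = z.re) (him : z'.im = z.im + t * z.re) :
    arg (z' / z) ∈ Set.Ico 0 Real.pi ∧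
      |arg (z' / z) - t * (z.re ^ 2 / normSq z)| ≤ 16 * t ^ 2 := by
  have hnorm : 0 < ‖z‖ := norm_pos_iff.2 hz
  have hratio : z' / z = 1 + ↑(t * z.re) * I / z := by
    rw [eq_comm, one_add_div hz, div_left_inj' hz]
    apply Complex.ext <;> simp [hre, him]
  have hsq : z.re ^ 2 / normSq z = (z.re / ‖z‖) ^ 2 := by rw [normSq_eq_norm_sq, div_pow]
  rw [hratio, hsq]
  refine arg_one_add_of_im_eq ht ?_ ?_ ?_
  · rw [abs_div, abs_norm]
    exact div_le_one_of_le₀ (abs_re_le_norm z) hnorm.le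
  · rw [← hsq, div_im]
    simp
    ring
  · rw [norm_div, norm_mul, norm_I, mul_one, norm_real, Real.norm_eq_abs, abs_mul, abs_of_nonneg ht,
      abs_div, abs_norm, mul_div_assoc]

theorem arg_div_horizontal_shear {z z' : ℂ} {t : ℝ} (ht : 0 ≤ t) (hz' : z' ≠ 0)
    (hre : z'.re = z.re - t * z.im) (him : z'.im = z.im) :
    arg (z' / z) ∈ Set.Ico 0 Real.pi ∧
      |arg (z' / z) - t * (z'.im ^ 2 / normSq z')| ≤ 16 * t ^ 2 := by
  have hnorm : 0 < ‖z'‖ := norm_pos_iff.2 hz'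
  have hratio : z / z' = 1 + ↑(t * z'.im) / z' := by
    rw [eq_comm, one_add_div hz', div_left_inj' hz']
    apply Complex.ext <;> simp [hre, him]
  have harg : arg (z' / z) = arg (1 + conj (↑(t * z'.im) / z')) := by
    rw [← inv_div, hratio, arg_inv, ← arg_conj, map_add, map_one]
  have hsq : z'.im ^ 2 / normSq z' = (z'.im / ‖z'‖) ^ 2 := by rw [normSq_eq_norm_sq, div_pow]
  rw [harg, hsq]
  refine arg_one_add_of_im_eq ht ?_ ?_ ?_
  · rw [abs_div, abs_norm]
    exact div_le_one_of_le₀ (abs_im_le_norm z') hnorm.le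
  · rw [← hsq, conj_im, div_im]
    simp
    ring
  · rw [RCLike.norm_conj, norm_div, norm_real, Real.norm_eq_abs, abs_mul, abs_of_nonneg ht,
      abs_div, abs_norm, mul_div_assoc]

/-- `θ` is an argument of `z` and lies in `[k * π, (k + 1) * π)`: the lift `θ` of the argument has
completed `k` half turns. -/
structure HalfTurns (z : ℂ) (θ : ℝ) (k : ℕ) : Prop where
  polar : ‖z‖ * exp (θ * I) = z
  le : k * Real.pi ≤ θ
  lt : θ < (k + 1) * Real.pi

theorem sin_ne_zero_and_sin_mul_sin_add_nonpos_iff {τ δ : ℝ} (hτ : τ ∈ Set.Ico 0 Real.pi)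
    (hδ : δ ∈ Set.Ico 0 Real.pi) :
    (Real.sin τ ≠ 0 ∧ Real.sin τ * Real.sin (τ + δ) ≤ 0) ↔ Real.pi ≤ τ + δ := by
  obtain ⟨hτ0, hτπ⟩ := hτ
  obtain ⟨hδ0, hδπ⟩ := hδ
  rcases hτ0.eq_or_lt with rfl | hpos
  · simp [hδπ]
  have hs : 0 < Real.sin τ := Real.sin_pos_of_pos_of_lt_pi hpos hτπ
  rw [and_iff_right hs.ne', ← not_lt, mul_pos_iff_of_pos_left hs, not_lt]
  constructor
  · contrapose!
    exact Real.sin_pos_of_pos_of_lt_pi (by linarith)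
  · intro hle
    rw [← Real.sin_sub_two_pi]
    exact Real.sin_nonpos_of_nonpos_of_neg_pi_le (by linarith) (by linarith)

namespace HalfTurns

variable {z z' : ℂ} {θ : ℝ} {k : ℕ}

theorem polar_rotate (h : HalfTurns z θ k) (hz : z ≠ 0) :
    ‖z'‖ * exp (↑(θ + arg (z' / z)) * I) = z' := by
  have hnorm : (‖z‖ : ℂ) ≠ 0 := ofReal_ne_zero.2 (norm_ne_zero_iff.2 hz)
  calc (‖z'‖ : ℂ) * exp (↑(θ + arg (z' / z)) * I)
      = ‖z‖ * exp (θ * I) * (↑‖z' / z‖ * exp (arg (z' / z) * I)) := by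
        rw [norm_div, ofReal_div, ofReal_add, add_mul, exp_add]
        field_simp
    _ = z' := by rw [h.polar, norm_mul_exp_arg_mul_I, mul_div_cancel₀ _ hz]

theorem im_eq (h : HalfTurns z θ k) : z.im = ‖z‖ * Real.sin θ := by
  rw [← exp_ofReal_mul_I_im, ← im_ofReal_mul, h.polar]

theorem isCrossing_iff (h : HalfTurns z θ k) (hz : z ≠ 0) (hz' : z' ≠ 0)
    (hδ : arg (z' / z) ∈ Set.Ico 0 Real.pi) :
    (z.im ≠ 0 ∧ z.im * z'.im ≤ 0) ↔ (k + 1) * Real.pi ≤ θ + arg (z' / z) := by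
  set δ := arg (z' / z)
  have hτ : θ - k * Real.pi ∈ Set.Ico 0 Real.pi :=
    ⟨sub_nonneg.2 h.le, by linarith [h.lt]⟩
  have him' : z'.im = ‖z'‖ * Real.sin (θ + δ) := by
    rw [← exp_ofReal_mul_I_im, ← im_ofReal_mul, h.polar_rotate hz]
  have hsign : ((-1 : ℝ) ^ k) * (-1) ^ k = 1 := by rw [← mul_pow]; simp
  have hturn := sin_ne_zero_and_sin_mul_sin_add_nonpos_iff hτ hδ
  rw [sub_add_eq_add_sub, Real.sin_sub_nat_mul_pi, Real.sin_sub_nat_mul_pi,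
    mul_mul_mul_comm, hsign, one_mul, le_sub_iff_add_le] at hturn
  rw [h.im_eq, him', mul_mul_mul_comm, ← not_lt (a := (0 : ℝ)), mul_pos_iff_of_pos_left
    (mul_pos (norm_pos_iff.2 hz) (norm_pos_iff.2 hz')), not_lt, add_one_mul, add_comm (_ * _),
    ← hturn]
  simp [hz]

theorem rotate (h : HalfTurns z θ k) (hz : z ≠ 0) (hz' : z' ≠ 0)
    (hδ : arg (z' / z) ∈ Set.Ico 0 Real.pi) :
    HalfTurns z' (θ + arg (z' / z)) (k + if z.im ≠ 0 ∧ z.im * z'.im ≤ 0 then 1 else 0) := by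
  have hcross := h.isCrossing_iff hz hz' hδ
  obtain ⟨hδ0, hδπ⟩ := hδ
  refine ⟨h.polar_rotate hz, ?_, ?_⟩
  all_goals
    split_ifs with hc
    · push_cast
      linarith [hcross.1 hc, h.lt]
    · rw [add_zero]
      linarith [not_le.1 (mt hcross.2 hc), h.le]

end HalfTurns

end Rotation

/-- The Prüfer vector at scale `s` of a solution `u` with flux `v`: its argument is the Prüfer
angle, and its imaginary part changes sign along with `u`. -/
noncomputable def pruferVector (s u v : ℝ) : ℂ := ⟨v / s, u⟩

theorem pruferVector_ne_zero {s u v : ℝ} (hs : s ≠ 0) (h : u ≠ 0 ∨ v ≠ 0) :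
    pruferVector s u v ≠ 0 := by
  simpa [pruferVector, Complex.ext_iff, hs, or_iff_not_imp_right, not_imp_not] using h

/-- The share of the flux from `n` to `n + 1` in the squared length of the Prüfer vector at scale
`s` of the free solution, when its flux has been updated from `n` to `n + 1` but its value has
not. -/
noncomputable def fluxFraction (a : ℤ → ℝ) (E s : ℝ) (n : ℕ) : ℝ :=
  ((freeSol a E (n + 1)).2 / s) ^ 2 /
    (((freeSol a E (n + 1)).2 / s) ^ 2 + (freeSol a E n).1 ^ 2)

theorem fluxFraction_nonneg (a : ℤ → ℝ) (E s : ℝ) (n : ℕ) : 0 ≤ fluxFraction a E s n := by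
  unfold fluxFraction
  positivity

theorem fluxFraction_le_one (a : ℤ → ℝ) (E s : ℝ) (n : ℕ) : fluxFraction a E s n ≤ 1 :=
  div_le_one_of_le₀ (le_add_of_nonneg_right (sq_nonneg _)) (by positivity)

/-- The rotation of the Prüfer vector at scale `s` over the step from `n` to `n + 1`, to first order
in `E / s` and `s / a (n + 1)`. -/
noncomputable def rotationRate (a : ℤ → ℝ) (E s : ℝ) (n : ℕ) : ℝ :=
  E / s * (1 - fluxFraction a E s n) + s / a (n + 1) * fluxFraction a E s n

section Prufer

variable {a : ℤ → ℝ} {E s : ℝ}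

-- A step of the recursion updates the flux, which shears the Prüfer vector horizontally, and then
-- the value, which shears it vertically.
theorem exists_halfTurns_step (ha : ∀ n, 0 < a n) (hE : 0 ≤ E) (hs : 0 < s) {n k : ℕ} {θ : ℝ}
    (h : HalfTurns (pruferVector s (freeSol a E n).1 (freeSol a E n).2) θ k) :
    ∃ δ, |δ - rotationRate a E s n| ≤ 16 * ((E / s) ^ 2 + (s / a (n + 1)) ^ 2) ∧
      HalfTurns (pruferVector s (freeSol a E (n + 1)).1 (freeSol a E (n + 1)).2) (θ + δ)
        (k + if IsCrossing (fun m => (freeSol a E m).1) n then 1 else 0) := by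
  let z := pruferVector s (freeSol a E n).1 (freeSol a E n).2
  let w := pruferVector s (freeSol a E n).1 (freeSol a E (n + 1)).2
  let z' := pruferVector s (freeSol a E (n + 1)).1 (freeSol a E (n + 1)).2
  have hsol := isSolution_freeSol ha E
  have hz : z ≠ 0 := pruferVector_ne_zero hs.ne' (hsol.nontrivial n)
  have hz' : z' ≠ 0 := pruferVector_ne_zero hs.ne' (hsol.nontrivial (n + 1))
  have hw : w ≠ 0 := pruferVector_ne_zero hs.ne' (hsol.nontrivial_flux_succ n)
  obtain ⟨hδ, hδ_le⟩ := arg_div_horizontal_shear (z := z) (z' := w) (t := E / s) (by positivity)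
    hw (by simp only [z, w, pruferVector, freeSol]; field_simp) rfl
  obtain ⟨hδ', hδ'_le⟩ := arg_div_vertical_shear (z := w) (z' := z') (t := s / a (n + 1))
    (div_nonneg hs.le (ha _).le) hw rfl (by
      simp only [z', w, pruferVector, freeSol]
      field_simp)
  have hre : w.re ^ 2 / Complex.normSq w = fluxFraction a E s n := by
    simp only [fluxFraction, w, pruferVector, Complex.normSq_mk, sq]
  have him : w.im ^ 2 / Complex.normSq w = 1 - fluxFraction a E s n := by
    rw [← hre, eq_sub_iff_add_eq, ← add_div, Complex.normSq_apply, sq, sq, add_comm]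
    exact div_self (by simpa [Complex.normSq_apply] using (Complex.normSq_pos.2 hw).ne')
  rw [him] at hδ_le
  rw [hre] at hδ'_le
  refine ⟨Complex.arg (w / z) + Complex.arg (z' / w), ?_, ?_⟩
  · rw [rotationRate, add_sub_add_comm, mul_add]
    exact (abs_add_le _ _).trans (add_le_add hδ_le hδ'_le)
  · have hno : ¬ (z.im ≠ 0 ∧ z.im * w.im ≤ 0) := fun hc =>
      (mul_self_pos.2 hc.1).not_ge hc.2
    have hmid := h.rotate hz hw hδ
    rw [if_neg hno, add_zero] at hmid
    rw [← add_assoc]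
    exact hmid.rotate hw hz' hδ'

theorem exists_halfTurns (ha : ∀ n, 0 < a n) (hE : 0 ≤ E) (hs : 0 < s) (N : ℕ) :
    ∃ θ, |θ - Real.pi / 2 - ∑ n ∈ Finset.range N, rotationRate a E s n| ≤
        16 * ∑ n ∈ Finset.range N, ((E / s) ^ 2 + (s / a (n + 1)) ^ 2) ∧
      HalfTurns (pruferVector s (freeSol a E N).1 (freeSol a E N).2) θ (freeCrossings a E N) := by
  induction N with
  | zero =>
    refine ⟨Real.pi / 2, by simp, ?_, ?_, ?_⟩
    · simp only [freeSol, pruferVector, zero_div]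
      rw [show (⟨0, 1⟩ : ℂ) = Complex.I from rfl]
      simp
    · simp [freeCrossings, crossings, Real.pi_div_two_pos.le]
    · simp [freeCrossings, crossings, Real.pi_pos]
  | succ N ih =>
    obtain ⟨θ, hθ, hturns⟩ := ih
    obtain ⟨δ, hδ, hstep⟩ := exists_halfTurns_step ha hE hs hturns
    refine ⟨θ + δ, ?_, ?_⟩
    · rw [Finset.sum_range_succ, Finset.sum_range_succ, mul_add]
      refine le_trans (le_of_eq ?_) ((abs_add_le _ _).trans (add_le_add hθ hδ))
      congr 1
      ring
    · rwa [freeCrossings, crossings, Nat.count_succ]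

theorem abs_pi_mul_freeCrossings_sub_le (ha : ∀ n, 0 < a n) (hE : 0 ≤ E) (hs : 0 < s) (N : ℕ) :
    |Real.pi * freeCrossings a E N - ∑ n ∈ Finset.range N, rotationRate a E s n| ≤
      Real.pi + 16 * ∑ n ∈ Finset.range N, ((E / s) ^ 2 + (s / a (n + 1)) ^ 2) := by
  obtain ⟨θ, hθ, hturns⟩ := exists_halfTurns ha hE hs N
  have hle := hturns.le
  have hlt := hturns.lt
  rw [abs_le] at hθ ⊢
  have := Real.pi_pos
  constructor <;> linarith

end Prufer

section LawOfLargeNumbers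

theorem exists_tendsto_of_eventually_abs_sub_le {x p e : ℕ → ℝ}
    (he : Tendsto e atTop (𝓝 0)) (h : ∀ L > 0, ∀ η > 0, ∀ᶠ N in atTop, |x N - p L| ≤ e L + η) :
    ∃ s, Tendsto p atTop (𝓝 s) ∧ Tendsto x atTop (𝓝 s) := by
  have hcauchy : CauchySeq x := by
    refine Metric.cauchySeq_iff'.2 fun ε hε => ?_
    obtain ⟨L, heL, hL⟩ :=
      ((he.eventually_lt_const (by positivity : 0 < ε / 4)).and (eventually_gt_atTop 0)).exists
    obtain ⟨N₀, hN₀⟩ := eventually_atTop.1 (h L hL (ε / 8) (by positivity))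
    refine ⟨N₀, fun n hn => ?_⟩
    have h₁ := hN₀ n hn
    have h₂ := hN₀ N₀ le_rfl
    have := abs_sub_le (x n) (p L) (x N₀)
    rw [abs_sub_comm (p L)] at this
    rw [Real.dist_eq]
    linarith
  obtain ⟨s, hs⟩ := cauchySeq_tendsto_of_complete hcauchy
  refine ⟨s, tendsto_iff_norm_sub_tendsto_zero.2 (squeeze_zero' (.of_forall fun _ =>
    norm_nonneg _) ((eventually_gt_atTop 0).mono fun L hL => ?_) he), hs⟩
  rw [Real.norm_eq_abs, abs_sub_comm]
  exact le_of_forall_pos_le_add fun η hη => le_of_tendsto (hs.sub_const _).abs (h L hL η hη)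

theorem tendsto_nat_div_div_self {L : ℕ} (hL : 0 < L) :
    Tendsto (fun N : ℕ => ((N / L : ℕ) : ℝ) / N) atTop (𝓝 (1 / L)) := by
  have hdiv := (tendsto_nat_floor_mul_div_atTop (R := ℝ) (a := 1 / L) (by positivity)).comp
    tendsto_natCast_atTop_atTop
  refine hdiv.congr fun N => ?_
  rw [Function.comp_apply, one_div_mul_eq_div, Nat.floor_div_eq_div]

theorem eventually_abs_div_sub_div_le {f g : ℕ → ℝ} {L : ℕ} {m C B : ℝ} (hL : 0 < L) (hC : 0 ≤ C)
    (hblock : ∀ k : ℕ, |f (k * L) - ∑ j ∈ Finset.range k, g j| ≤ C * k)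
    (hrest : ∀ k, ∀ r < L, |f (k * L + r) - f (k * L)| ≤ B)
    (hg : Tendsto (fun k : ℕ => (∑ j ∈ Finset.range k, g j) / k) atTop (𝓝 m))
    {η : ℝ} (hη : 0 < η) : ∀ᶠ N : ℕ in atTop, |f N / N - m / L| ≤ C / L + η := by
  have hsum : Tendsto (fun N : ℕ => (∑ j ∈ Finset.range (N / L), g j) / N) atTop (𝓝 (m / L)) := by
    have := (hg.comp (Nat.tendsto_div_const_atTop hL.ne')).mul (tendsto_nat_div_div_self hL)
    rw [mul_one_div] at this
    refine this.congr' ?_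
    filter_upwards [eventually_ge_atTop L] with N hN
    have : ((N / L : ℕ) : ℝ) ≠ 0 := Nat.cast_ne_zero.2 (Nat.div_pos hN hL).ne'
    simp only [Function.comp_apply]
    field_simp
  filter_upwards [Metric.tendsto_nhds.1 hsum (η / 2) (by positivity),
    (tendsto_const_div_atTop_nhds_zero_nat B).eventually_lt_const (half_pos hη)] with N hN hBN
  have hfirst : |f N - ∑ j ∈ Finset.range (N / L), g j| ≤ C * (N / L : ℕ) + B := by
    have h := hrest (N / L) (N % L) (Nat.mod_lt _ hL)
    rw [Nat.div_add_mod'] at h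
    exact (abs_sub_le _ _ _).trans ((add_le_add h (hblock _)).trans_eq (add_comm _ _))
  have hdiv : |f N / N - (∑ j ∈ Finset.range (N / L), g j) / N| ≤ C / L + B / N := by
    rw [← sub_div, abs_div, Nat.abs_cast]
    have hratio : ((N / L : ℕ) : ℝ) / N ≤ 1 / L :=
      div_le_of_le_mul₀ (by positivity) (by positivity)
        (Nat.cast_div_le.trans_eq (one_div_mul_eq_div _ _).symm)
    calc |f N - ∑ j ∈ Finset.range (N / L), g j| / N
        ≤ (C * (N / L : ℕ) + B) / N := by gcongr
      _ = C * (((N / L : ℕ) : ℝ) / N) + B / N := by ring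
      _ ≤ C * (1 / L) + B / N :=
        add_le_add_left (mul_le_mul_of_nonneg_left hratio hC) _
      _ = C / L + B / N := by rw [mul_one_div]
  rw [Real.dist_eq] at hN
  exact (abs_sub_le _ _ _).trans
    ((add_le_add (hdiv.trans (add_le_add_right hBN.le _)) hN.le).trans_eq (by ring))

theorem abs_sub_sum_blocks_le {α : Type*} {F : ℕ → (ℤ → α) → ℝ} {b : ℤ → α} {C : ℝ}
    (hF₀ : F 0 b = 0)
    (hadd : ∀ m n : ℕ, |F (m + n) b - (F m b + F n fun k => b (m + k))| ≤ C) (L k : ℕ) :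
    |F (k * L) b - ∑ j ∈ Finset.range k, F L fun i => b ((j * L : ℕ) + i)| ≤ C * k := by
  induction k with
  | zero => simp [hF₀]
  | succ k ih =>
    have h := hadd (k * L) L
    rw [Finset.sum_range_succ, Nat.succ_mul, Nat.cast_succ]
    rw [abs_le] at h ih ⊢
    constructor <;> linarith

variable {Ω : Type*} [MeasurableSpace Ω] {μ : Measure Ω}

theorem indepFun_of_dependsOn {ι α β γ : Type*} [MeasurableSpace α] [MeasurableSpace β]
    [MeasurableSpace γ] {a : ι → Ω → α} (ha_meas : ∀ i, AEMeasurable (a i) μ)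
    (ha_indep : iIndepFun a μ) {S T : Finset ι} (hST : Disjoint S T)
    {F : (ι → α) → β} {G : (ι → α) → γ} (hF : Measurable F) (hG : Measurable G)
    (hFS : DependsOn F S) (hGT : DependsOn G T) :
    IndepFun (fun ω => F fun i => a i ω) (fun ω => G fun i => a i ω) μ := by
  classical
  have : IsProbabilityMeasure μ := ha_indep.isProbabilityMeasure
  obtain ⟨ω₀⟩ := nonempty_of_isProbabilityMeasure μ
  let extend (U : Finset ι) : (U → α) → ι → α := Function.updateFinset (fun i => a i ω₀) U
  have hextend (U : Finset ι) (b : ι → α) : ∀ i ∈ U, b i = extend U (fun i => b i) i :=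
    fun i hi => by simp [extend, Function.updateFinset, hi]
  have h := (ha_indep.indepFun_finset₀ S T hST ha_meas).comp
    (hF.comp measurable_updateFinset : Measurable (F ∘ extend S))
    (hG.comp measurable_updateFinset : Measurable (G ∘ extend T))
  convert h using 1
  · exact funext fun ω => hFS (hextend S _)
  · exact funext fun ω => hGT (hextend T _)

variable {α : Type*} [MeasurableSpace α] {a : ℤ → Ω → α}

theorem identDistrib_shift (ha_indep : iIndepFun a μ)
    (ha_ident : ∀ n, IdentDistrib (a n) (a 0) μ μ) (m : ℤ) :
    IdentDistrib (fun ω k => a (m + k) ω) (fun ω k => a k ω) μ μ :=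
  .pi (fun k => (ha_ident (m + k)).trans (ha_ident k).symm)
    (ha_indep.precomp (add_right_injective m)) ha_indep

theorem tendsto_average_blocks {F : (ℤ → α) → ℝ} {L : ℕ} (ha_indep : iIndepFun a μ)
    (ha_ident : ∀ n, IdentDistrib (a n) (a 0) μ μ) (hF : Measurable F)
    (hdep : DependsOn F (Finset.Ioc (0 : ℤ) L)) (hint : Integrable (fun ω => F fun k => a k ω) μ) :
    ∀ᵐ ω ∂μ, Tendsto (fun k : ℕ => (∑ j ∈ Finset.range k, F fun i => a ((j * L : ℕ) + i) ω) / k)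
      atTop (𝓝 (∫ ω, F (fun k => a k ω) ∂μ)) := by
  let X (j : ℕ) (ω : Ω) : ℝ := F fun i => a ((j * L : ℕ) + i) ω
  have hident (j : ℕ) : IdentDistrib (X j) (fun ω => F fun k => a k ω) μ μ :=
    (identDistrib_shift ha_indep ha_ident _).comp hF
  have hmeas (t : ℤ) : Measurable fun (b : ℤ → α) (i : ℤ) => b (t + i) := by fun_prop
  have hdep_shift (t : ℤ) : DependsOn (fun b : ℤ → α => F fun i => b (t + i))
      (Finset.Ioc t (t + L)) := fun b c hbc =>
    hdep fun k hk => hbc _ (by simp only [Finset.coe_Ioc, Set.mem_Ioc] at hk ⊢; omega)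
  have hindep : Pairwise fun i j => IndepFun (X i) (X j) μ := by
    have : Std.Symm fun i j => IndepFun (X i) (X j) μ := ⟨fun _ _ h => h.symm⟩
    refine Pairwise.of_lt fun i j hij => indepFun_of_dependsOn
      (fun n => (ha_ident n).aemeasurable_fst) ha_indep (Finset.disjoint_left.2 fun k hk hk' => ?_)
      (hF.comp (hmeas _)) (hF.comp (hmeas _)) (hdep_shift _) (hdep_shift _)
    have : (i + 1) * L ≤ j * L := Nat.mul_le_mul_right L hij
    simp only [Finset.mem_Ioc] at hk hk'
    grind
  have := strong_law_ae_real X ((hident 0).integrable_iff.2 hint) hindep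
    fun j => (hident j).trans (hident 0).symm
  rwa [(hident 0).integral_eq] at this

theorem exists_tendsto_div_of_almostAdditive {F : ℕ → (ℤ → α) → ℝ} {B : ℕ → ℝ} {C : ℝ}
    (ha_indep : iIndepFun a μ) (ha_ident : ∀ n, IdentDistrib (a n) (a 0) μ μ)
    (hF : ∀ N, Measurable (F N)) (hdep : ∀ N : ℕ, DependsOn (F N) (Finset.Ioc (0 : ℤ) N))
    (hB : ∀ N b, |F N b| ≤ B N) (hF₀ : ∀ b, F 0 b = 0)
    (hadd : ∀ᵐ ω ∂μ, ∀ m n : ℕ, |F (m + n) (fun k => a k ω) -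
      (F m (fun k => a k ω) + F n fun k => a (m + k) ω)| ≤ C) :
    ∃ s, Tendsto (fun N : ℕ => (∫ ω, F N (fun k => a k ω) ∂μ) / N) atTop (𝓝 s) ∧
      ∀ᵐ ω ∂μ, Tendsto (fun N : ℕ => F N (fun k => a k ω) / N) atTop (𝓝 s) := by
  have : IsProbabilityMeasure μ := ha_indep.isProbabilityMeasure
  have hmeas : AEMeasurable (fun ω k => a k ω) μ :=
    aemeasurable_pi_lambda _ fun n => (ha_ident n).aemeasurable_fst
  have hint (N : ℕ) : Integrable (fun ω => F N fun k => a k ω) μ :=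
    .of_bound ((hF N).comp_aemeasurable hmeas).aestronglyMeasurable (B N)
      (ae_of_all _ fun ω => hB N _)
  have hlim : ∀ᵐ ω ∂μ, ∃ s, Tendsto (fun N : ℕ => (∫ ω, F N (fun k => a k ω) ∂μ) / N)
      atTop (𝓝 s) ∧ Tendsto (fun N : ℕ => F N (fun k => a k ω) / N) atTop (𝓝 s) := by
    filter_upwards [hadd, ae_all_iff.2 fun L =>
      tendsto_average_blocks ha_indep ha_ident (hF L) (hdep L) (hint L)] with ω hω haverage
    refine exists_tendsto_of_eventually_abs_sub_le
      (tendsto_const_div_atTop_nhds_zero_nat C) fun L hL η hη =>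
      eventually_abs_div_sub_div_le (C := C) (B := C + ∑ r ∈ Finset.range L, B r) hL
        ((abs_nonneg _).trans (hω 0 0)) (abs_sub_sum_blocks_le (hF₀ _) hω L)
        (fun k r hr => ?_) (haverage L) hη
    have hr := (hB r fun i => a ((k * L : ℕ) + i) ω).trans (Finset.single_le_sum
      (fun r _ => (abs_nonneg _).trans (hB r fun i => a i ω)) (Finset.mem_range.2 hr))
    have := hω (k * L) r
    rw [abs_le] at *
    constructor <;> linarith
  obtain ⟨ω₀, s, hs, -⟩ := hlim.exists
  refine ⟨s, hs, hlim.mono fun ω hω => ?_⟩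
  obtain ⟨s', hs', h⟩ := hω
  rwa [tendsto_nhds_unique hs hs']

end LawOfLargeNumbers

section Measurability

theorem measurable_freeSol (E : ℝ) (n : ℕ) : Measurable fun a : ℤ → ℝ => freeSol a E n := by
  induction n with
  | zero => exact measurable_const
  | succ n ih =>
    simp only [freeSol]
    fun_prop

theorem measurable_fluxFraction (E s : ℝ) (n : ℕ) :
    Measurable fun a : ℤ → ℝ => fluxFraction a E s n := by
  have := measurable_freeSol E n
  simp only [fluxFraction, freeSol]
  fun_prop

theorem measurable_freeCrossings (E : ℝ) (N : ℕ) :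
    Measurable fun a : ℤ → ℝ => freeCrossings a E N := by
  induction N with
  | zero => exact measurable_const
  | succ N ih =>
    have hN := (measurable_freeSol E N).fst
    have hN' := (measurable_freeSol E (N + 1)).fst
    simp only [freeCrossings, crossings, Nat.count_succ]
    exact ih.add (.ite ((hN (measurableSet_singleton 0).compl).inter
      (measurableSet_le (hN.mul hN') measurable_const)) measurable_const measurable_const)

theorem dependsOn_freeSol (E : ℝ) (n : ℕ) :
    DependsOn (fun a => freeSol a E n) (Finset.Ioc (0 : ℤ) n) := by
  intro a b hab
  induction n with
  | zero => rfl
  | succ n ih =>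
    have hsol := ih fun k hk => hab k (Finset.Ioc_subset_Ioc_right (by simp) hk)
    simp only [freeSol, hsol, hab (n + 1) (by simp)]

theorem dependsOn_fluxFraction (E s : ℝ) (n : ℕ) :
    DependsOn (fun a => fluxFraction a E s n) (Finset.Ioc (0 : ℤ) n) := fun a b hab => by
  simp only [fluxFraction, freeSol, dependsOn_freeSol E n hab]

theorem dependsOn_freeCrossings (E : ℝ) (N : ℕ) :
    DependsOn (fun a => freeCrossings a E N) (Finset.Ioc (0 : ℤ) N) := by
  intro a b hab
  have hsol (n : ℕ) (hn : n ≤ N) : freeSol a E n = freeSol b E n :=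
    dependsOn_freeSol E n fun k hk => hab k (Finset.Ioc_subset_Ioc_right (by exact_mod_cast hn) hk)
  simp only [freeCrossings, crossings, Nat.count_eq_card_filter_range, IsCrossing]
  congr 1
  refine Finset.filter_congr fun n hn => ?_
  rw [hsol n (Finset.mem_range.1 hn).le, hsol (n + 1) (Finset.mem_range.1 hn)]

end Measurability

section Random

variable {Ω : Type*} [MeasurableSpace Ω] {μ : Measure Ω} {a : ℤ → Ω → ℝ}

theorem ae_forall_pos (ha_ident : ∀ n, IdentDistrib (a n) (a 0) μ μ)
    (ha_pos : ∀ᵐ ω ∂μ, 0 < a 0 ω) : ∀ᵐ ω ∂μ, ∀ n, 0 < a n ω :=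
  ae_all_iff.2 fun n => (ha_ident n).symm.ae_mem_snd measurableSet_Ioi ha_pos

theorem exists_isIDS (ha_indep : iIndepFun a μ) (ha_ident : ∀ n, IdentDistrib (a n) (a 0) μ μ)
    (ha_pos : ∀ᵐ ω ∂μ, 0 < a 0 ω) :
    ∃ 𝒩 : ℝ → ℝ, IsIDS μ a 𝒩 ∧ ∀ E, Tendsto
      (fun N : ℕ => (∫ ω, (freeCrossings (fun k => a k ω) E N : ℝ) ∂μ) / N) atTop (𝓝 (𝒩 E)) := by
  have hpos := ae_forall_pos ha_ident ha_pos
  choose 𝒩 hmean hcrossings using fun E => exists_tendsto_div_of_almostAdditive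
    (F := fun N b => (freeCrossings b E N : ℝ)) (B := fun N => N) (C := 2) ha_indep ha_ident
    (fun N => measurable_from_top.comp (measurable_freeCrossings E N))
    (fun N _ _ hbc => congrArg Nat.cast (dependsOn_freeCrossings E N hbc))
    (fun N b => by rw [Nat.abs_cast]; exact_mod_cast freeCrossings_le b E N)
    (fun _ => Nat.cast_zero)
    (hpos.mono fun ω hω m n => abs_freeCrossings_add_sub_le hω E m n)
  refine ⟨𝒩, fun E => ?_, hmean⟩
  filter_upwards [hcrossings E, hpos] with ω hω hpos
  have hdiff : Tendsto (fun N : ℕ => ((eigCount (fun n => a n ω) N E : ℝ) -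
      freeCrossings (fun k => a k ω) E N) / N) atTop (𝓝 0) := by
    refine squeeze_zero_norm (fun N => ?_) (tendsto_const_div_atTop_nhds_zero_nat (1 : ℝ))
    rw [norm_div, Real.norm_natCast, Real.norm_eq_abs]
    gcongr
    exact abs_eigCount_sub_freeCrossings_le hpos E N
  have := hω.add hdiff
  simp only [← add_div, add_sub_cancel, add_zero] at this
  exact this

theorem IsIDS.unique [NeZero μ] {𝒩 𝒩' : ℝ → ℝ} (h : IsIDS μ a 𝒩) (h' : IsIDS μ a 𝒩') : 𝒩 = 𝒩' := by
  ext E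
  obtain ⟨ω, hω, hω'⟩ := ((h E).and (h' E)).exists
  exact tendsto_nhds_unique hω hω'

theorem kappa_pos [NeZero μ] (ha_pos : ∀ᵐ ω ∂μ, 0 < a 0 ω)
    (ha_inv : Integrable (fun ω => (a 0 ω)⁻¹) μ) : 0 < kappa μ a := by
  have hinv : ∀ᵐ ω ∂μ, 0 < (a 0 ω)⁻¹ := ha_pos.mono fun _ => inv_pos.2
  rw [kappa, inv_pos]
  refine (integral_nonneg_of_ae (hinv.mono fun _ => le_of_lt)).lt_of_ne' fun hzero => ?_
  rw [integral_eq_zero_iff_of_nonneg_ae (hinv.mono fun _ => le_of_lt) ha_inv] at hzero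
  obtain ⟨ω, h, h'⟩ := (hinv.and hzero).exists
  exact h.ne' h'

theorem identDistrib_inv (ha_ident : ∀ n, IdentDistrib (a n) (a 0) μ μ) (n : ℤ) :
    IdentDistrib (fun ω => (a n ω)⁻¹) (fun ω => (a 0 ω)⁻¹) μ μ :=
  (ha_ident n).comp measurable_inv

theorem indepFun_inv_fluxFraction (ha_indep : iIndepFun a μ)
    (ha_ident : ∀ n, IdentDistrib (a n) (a 0) μ μ) (E s : ℝ) (n : ℕ) :
    IndepFun (fun ω => (a (n + 1) ω)⁻¹) (fun ω => fluxFraction (fun k => a k ω) E s n) μ :=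
  indepFun_of_dependsOn (fun n => (ha_ident n).aemeasurable_fst) ha_indep
    (S := {(n : ℤ) + 1}) (T := Finset.Ioc 0 n) (by simp) (F := fun b => (b (n + 1))⁻¹)
    (by fun_prop) (measurable_fluxFraction E s n)
    (fun _ _ hbc => congrArg _ (hbc _ (by simp))) (dependsOn_fluxFraction E s n)

theorem integrable_fluxFraction [IsFiniteMeasure μ] (ha : ∀ n, AEMeasurable (a n) μ) (E s : ℝ)
    (n : ℕ) : Integrable (fun ω => fluxFraction (fun k => a k ω) E s n) μ := by
  refine .of_bound ((measurable_fluxFraction E s n).comp_aemeasurable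
    (aemeasurable_pi_lambda _ ha)).aestronglyMeasurable 1 (ae_of_all _ fun ω => ?_)
  rw [Real.norm_of_nonneg (fluxFraction_nonneg _ _ _ _)]
  exact fluxFraction_le_one _ _ _ _

theorem integrable_inv_mul_fluxFraction (ha_indep : iIndepFun a μ)
    (ha_ident : ∀ n, IdentDistrib (a n) (a 0) μ μ)
    (ha_inv : Integrable (fun ω => (a 0 ω)⁻¹) μ) (E s : ℝ) (n : ℕ) :
    Integrable (fun ω => (a (n + 1) ω)⁻¹ * fluxFraction (fun k => a k ω) E s n) μ :=
  have : IsProbabilityMeasure μ := ha_indep.isProbabilityMeasure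
  (indepFun_inv_fluxFraction ha_indep ha_ident E s n).integrable_mul
    ((identDistrib_inv ha_ident _).integrable_iff.2 ha_inv)
    (integrable_fluxFraction (fun n => (ha_ident n).aemeasurable_fst) E s n)

theorem integral_inv_mul_fluxFraction (ha_indep : iIndepFun a μ)
    (ha_ident : ∀ n, IdentDistrib (a n) (a 0) μ μ) (E s : ℝ) (n : ℕ) :
    ∫ ω, (a (n + 1) ω)⁻¹ * fluxFraction (fun k => a k ω) E s n ∂μ =
      (kappa μ a)⁻¹ * ∫ ω, fluxFraction (fun k => a k ω) E s n ∂μ := by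
  have : IsProbabilityMeasure μ := ha_indep.isProbabilityMeasure
  have hinv := identDistrib_inv ha_ident (n + 1)
  have hq := integrable_fluxFraction (fun n => (ha_ident n).aemeasurable_fst) E s n
  rw [(indepFun_inv_fluxFraction ha_indep ha_ident E s n).integral_fun_mul_eq_mul_integral
    hinv.aemeasurable_fst.aestronglyMeasurable hq.1, hinv.integral_eq, kappa, inv_inv]

theorem integrable_rotationRate (ha_indep : iIndepFun a μ)
    (ha_ident : ∀ n, IdentDistrib (a n) (a 0) μ μ)
    (ha_inv : Integrable (fun ω => (a 0 ω)⁻¹) μ) (E s : ℝ) (n : ℕ) :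
    Integrable (fun ω => rotationRate (fun k => a k ω) E s n) μ := by
  have : IsProbabilityMeasure μ := ha_indep.isProbabilityMeasure
  have hq := integrable_fluxFraction (fun n => (ha_ident n).aemeasurable_fst) E s n
  simp only [rotationRate, div_eq_mul_inv s, mul_assoc]
  exact (((integrable_const 1).sub hq).const_mul _).add
    ((integrable_inv_mul_fluxFraction ha_indep ha_ident ha_inv E s n).const_mul s)

-- At the scale where both shears have the same mean rate, the mean rotation does not depend on the
-- Prüfer angle.
theorem integral_rotationRate (ha_indep : iIndepFun a μ)
    (ha_ident : ∀ n, IdentDistrib (a n) (a 0) μ μ)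
    (ha_inv : Integrable (fun ω => (a 0 ω)⁻¹) μ) {E s : ℝ} (hs : E / s = s / kappa μ a) (n : ℕ) :
    ∫ ω, rotationRate (fun k => a k ω) E s n ∂μ = E / s := by
  have : IsProbabilityMeasure μ := ha_indep.isProbabilityMeasure
  have hq := integrable_fluxFraction (fun n => (ha_ident n).aemeasurable_fst) E s n
  have hprod := integrable_inv_mul_fluxFraction ha_indep ha_ident ha_inv E s n
  simp only [rotationRate, div_eq_mul_inv s, mul_assoc]
  rw [integral_add (by fun_prop) (by fun_prop), integral_const_mul, integral_const_mul,
    integral_sub (by fun_prop) hq, integral_inv_mul_fluxFraction ha_indep ha_ident, ← mul_assoc s,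
    ← div_eq_mul_inv, ← hs, ← mul_add, integral_const, probReal_univ, one_smul, sub_add_cancel,
    mul_one]

theorem integrable_freeCrossings [IsFiniteMeasure μ] (ha : ∀ n, AEMeasurable (a n) μ) (E : ℝ)
    (N : ℕ) : Integrable (fun ω => (freeCrossings (fun k => a k ω) E N : ℝ)) μ := by
  refine .of_bound (measurable_from_top.comp_aemeasurable ((measurable_freeCrossings E N
    ).comp_aemeasurable (aemeasurable_pi_lambda _ ha))).aestronglyMeasurable N
    (ae_of_all _ fun ω => ?_)
  rw [Real.norm_natCast]
  exact_mod_cast freeCrossings_le _ E N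

theorem integrable_sq_shears (ha_ident : ∀ n, IdentDistrib (a n) (a 0) μ μ) [IsFiniteMeasure μ]
    (ha_inv : MemLp (fun ω => (a 0 ω)⁻¹) 2 μ) (t s : ℝ) (n : ℤ) :
    Integrable (fun ω => t ^ 2 + (s / a n ω) ^ 2) μ := by
  simp only [div_eq_mul_inv s, mul_pow]
  exact (integrable_const _).add
    (((identDistrib_inv ha_ident n).memLp_iff.2 ha_inv).integrable_sq.const_mul _)

theorem integral_sq_shears [IsProbabilityMeasure μ] (ha_ident : ∀ n, IdentDistrib (a n) (a 0) μ μ)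
    (ha_inv : MemLp (fun ω => (a 0 ω)⁻¹) 2 μ) (t s : ℝ) (n : ℤ) :
    ∫ ω, t ^ 2 + (s / a n ω) ^ 2 ∂μ = t ^ 2 + s ^ 2 * ∫ ω, (a 0 ω)⁻¹ ^ 2 ∂μ := by
  have hsq : IdentDistrib (fun ω => (a n ω)⁻¹ ^ 2) (fun ω => (a 0 ω)⁻¹ ^ 2) μ μ :=
    (identDistrib_inv ha_ident n).pow
  have hint := hsq.integrable_iff.2 ha_inv.integrable_sq
  simp only [div_eq_mul_inv s, mul_pow]
  rw [integral_add (integrable_const _) (hint.const_mul _), integral_const_mul, hsq.integral_eq]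
  simp

theorem abs_pi_mul_integral_freeCrossings_sub_le (ha_indep : iIndepFun a μ)
    (ha_ident : ∀ n, IdentDistrib (a n) (a 0) μ μ) (ha_pos : ∀ᵐ ω ∂μ, 0 < a 0 ω)
    (ha_inv : MemLp (fun ω => (a 0 ω)⁻¹) 2 μ) {E s : ℝ} (hE : 0 ≤ E) (hs : 0 < s)
    (hEs : E / s = s / kappa μ a) (N : ℕ) :
    |Real.pi * ∫ ω, (freeCrossings (fun k => a k ω) E N : ℝ) ∂μ - N * (E / s)| ≤
      Real.pi + 16 * (N * ((E / s) ^ 2 + s ^ 2 * ∫ ω, (a 0 ω)⁻¹ ^ 2 ∂μ)) := by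
  have : IsProbabilityMeasure μ := ha_indep.isProbabilityMeasure
  have hinv := ha_inv.integrable one_le_two
  have hcrossings := integrable_freeCrossings (fun n => (ha_ident n).aemeasurable_fst) E N
  have hrate := integrable_finsetSum (Finset.range N) fun n _ =>
    integrable_rotationRate ha_indep ha_ident hinv E s n
  have herror := integrable_finsetSum (Finset.range N) fun n _ =>
    integrable_sq_shears ha_ident ha_inv (E / s) s (n + 1)
  calc |Real.pi * ∫ ω, (freeCrossings (fun k => a k ω) E N : ℝ) ∂μ - N * (E / s)|
      = ‖∫ ω, (Real.pi * freeCrossings (fun k => a k ω) E N -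
          ∑ n ∈ Finset.range N, rotationRate (fun k => a k ω) E s n) ∂μ‖ := by
        rw [integral_sub (hcrossings.const_mul _) hrate, integral_const_mul, integral_finsetSum _
          fun n _ => integrable_rotationRate ha_indep ha_ident hinv E s n]
        simp [integral_rotationRate ha_indep ha_ident hinv hEs]
    _ ≤ ∫ ω, (Real.pi +
          16 * ∑ n ∈ Finset.range N, ((E / s) ^ 2 + (s / a (n + 1) ω) ^ 2)) ∂μ := by
        refine norm_integral_le_of_norm_le ((integrable_const _).add (herror.const_mul _)) ?_
        filter_upwards [ae_forall_pos ha_ident ha_pos] with ω hω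
        exact abs_pi_mul_freeCrossings_sub_le hω hE hs N
    _ = _ := by
        rw [integral_add (integrable_const _) (herror.const_mul _), integral_const_mul,
          integral_finsetSum _ fun (n : ℕ) _ =>
            integrable_sq_shears ha_ident ha_inv (E / s) s (n + 1)]
        simp only [integral_const, probReal_univ, one_smul, integral_sq_shears ha_ident ha_inv,
          Finset.sum_const, Finset.card_range, nsmul_eq_mul]

theorem abs_pi_mul_sub_le_of_tendsto (ha_indep : iIndepFun a μ)
    (ha_ident : ∀ n, IdentDistrib (a n) (a 0) μ μ) (ha_pos : ∀ᵐ ω ∂μ, 0 < a 0 ω)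
    (ha_inv : MemLp (fun ω => (a 0 ω)⁻¹) 2 μ) {E ν : ℝ} (hE : 0 < E)
    (hν : Tendsto (fun N : ℕ => (∫ ω, (freeCrossings (fun k => a k ω) E N : ℝ) ∂μ) / N)
      atTop (𝓝 ν)) :
    |Real.pi * ν - √E / √(kappa μ a)| ≤
      16 * ((kappa μ a)⁻¹ + kappa μ a * ∫ ω, (a 0 ω)⁻¹ ^ 2 ∂μ) * E := by
  have : IsProbabilityMeasure μ := ha_indep.isProbabilityMeasure
  have hκ := kappa_pos ha_pos (ha_inv.integrable one_le_two)
  set κ := kappa μ a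
  have hscale : E / (√E * √κ) = √E / √κ := by rw [div_mul_eq_div_div, Real.div_sqrt]
  have hscale' : √E * √κ / κ = √E / √κ := by rw [mul_div_assoc, Real.sqrt_div_self', mul_one_div]
  have hbound (N : ℕ) := abs_pi_mul_integral_freeCrossings_sub_le ha_indep ha_ident ha_pos ha_inv
    hE.le (s := √E * √κ) (by positivity) (hscale.trans hscale'.symm) N
  simp only [hscale, div_pow, mul_pow, Real.sq_sqrt hE.le, Real.sq_sqrt hκ.le] at hbound
  have herror := (tendsto_const_div_atTop_nhds_zero_nat Real.pi).add_const
    (16 * (κ⁻¹ + κ * ∫ ω, (a 0 ω)⁻¹ ^ 2 ∂μ) * E)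
  rw [zero_add] at herror
  refine le_of_tendsto_of_tendsto ((hν.const_mul _).sub_const _).abs herror ?_
  filter_upwards [eventually_gt_atTop 0] with N hN
  have hN : (0 : ℝ) < N := Nat.cast_pos.2 hN
  have := div_le_div_of_nonneg_right (hbound N) hN.le
  rw [← abs_of_pos hN, ← abs_div, abs_of_pos hN] at this
  convert this using 1
  · congr 1
    field_simp
  · field_simp

end Random

end DivGrad

theorem theorem2p1_general {Ω : Type*} [MeasurableSpace Ω] (μ : Measure Ω)
    (a : ℤ → Ω → ℝ) (ha_indep : iIndepFun a μ) (ha_ident : ∀ n, IdentDistrib (a n) (a 0) μ μ)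
    (ha_pos : ∀ᵐ ω ∂μ, 0 < a 0 ω) (ha_inv : MemLp (fun ω => (a 0 ω)⁻¹) 2 μ) :
    (∃ 𝒩 : ℝ → ℝ, DivGrad.IsIDS μ a 𝒩) ∧
      ∀ 𝒩 : ℝ → ℝ, DivGrad.IsIDS μ a 𝒩 →
        (fun E : ℝ => 𝒩 E - 1 / (Real.pi * √(DivGrad.kappa μ a)) * √E)
          =O[𝓝[>] 0] (fun E : ℝ => E) := by
  have : IsProbabilityMeasure μ := ha_indep.isProbabilityMeasure
  obtain ⟨𝒩, hids, hmean⟩ := DivGrad.exists_isIDS ha_indep ha_ident ha_pos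
  refine ⟨⟨𝒩, hids⟩, fun 𝒩' hids' => ?_⟩
  obtain rfl := hids.unique hids'
  refine .of_bound (16 * ((DivGrad.kappa μ a)⁻¹ + DivGrad.kappa μ a *
    ∫ ω, (a 0 ω)⁻¹ ^ 2 ∂μ) / Real.pi) ?_
  filter_upwards [self_mem_nhdsWithin] with E (hE : 0 < E)
  have hbound := DivGrad.abs_pi_mul_sub_le_of_tendsto ha_indep ha_ident ha_pos ha_inv hE (hmean E)
  have hpi : 𝒩 E - 1 / (Real.pi * √(DivGrad.kappa μ a)) * √E =
      (Real.pi * 𝒩 E - √E / √(DivGrad.kappa μ a)) / Real.pi := by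
    rw [sub_div, mul_div_cancel_left₀ _ Real.pi_ne_zero]
    ring
  rw [hpi, norm_div, Real.norm_of_nonneg Real.pi_pos.le, Real.norm_of_nonneg hE.le,
    div_mul_eq_mul_div]
  exact div_le_div_of_nonneg_right hbound Real.pi_pos.le

theorem theorem2p1 {Ω : Type*} [MeasurableSpace Ω] (μ : Measure Ω) [IsProbabilityMeasure μ]
    (a : ℤ → Ω → ℝ) (ha_meas : ∀ n, Measurable (a n))
    (ha_indep : iIndepFun a μ) (ha_ident : ∀ n, IdentDistrib (a n) (a 0) μ μ)
    (aminus aplus : ℝ) (ha_pos : 0 < aminus)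
    (ha_bound : ∀ᵐ ω ∂μ, ∀ n, aminus ≤ a n ω ∧ a n ω ≤ aplus) :
    (∃ 𝒩 : ℝ → ℝ, DivGrad.IsIDS μ a 𝒩) ∧
      ∀ 𝒩 : ℝ → ℝ, DivGrad.IsIDS μ a 𝒩 →
        (fun E : ℝ => 𝒩 E - 1 / (Real.pi * √(DivGrad.kappa μ a)) * √E)
          =O[𝓝[>] 0] (fun E : ℝ => E) := by
  refine theorem2p1_general μ a ha_indep ha_ident
    (ha_bound.mono fun ω hω => ha_pos.trans_le (hω 0).1)
    (.of_bound (ha_meas 0).inv.aestronglyMeasurable aminus⁻¹ (ha_bound.mono fun ω hω => ?_))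
  rw [norm_inv, Real.norm_of_nonneg (ha_pos.le.trans (hω 0).1)]
  exact inv_anti₀ ha_pos (hω 0).1
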